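/- Consider the discrete-time quantum walk on $\ell^2(\mathbb Z)\otimes\mathbb C^2$ with one-step operator $U_\Theta=S(\mathbb 1\otimes C_\Theta)$, where $S=\sum_x |x+1\rangle\langle x|\otimes|0\rangle\langle 0|+|x-1\rangle\langle x|\otimes|1\rangle\langle 1|$ and $$C_\Theta=\begin{pmatrix} e^{i\alpha}\cos\theta & e^{i\beta}\sin\theta\\ -e^{-i\beta}\sin\theta & e^{-i\alpha}\cos\theta\end{pmatrix},\qquad \Theta=(\theta,\alpha,\beta)\in\mathbb R^3 .$$ For a unit vector $\Psi(0)$ put $\Psi_\Theta(t)=U_\Theta^t\Psi(0)$, and let $$F_{\mu\nu}(t)=4\,\mathrm{Re}\big(\langle\partial_\mu\Psi|\partial_\nu\Psi\rangle-\langle\partial_\mu\Psi|\Psi\rangle\langle\Psi|\partial_\nu\Psi\rangle\big),\qquad \mu,\nu\in\{\theta,\alpha,\beta\},$$ be the quantum Fisher information (QFI) matrix of $\Psi=\Psi_\Theta(t)$. Let $u_k=\mathrm{diag}(e^{-ik},e^{ik})\,C_\Theta$ and $O_\mu=u_k^\dagger\,\partial_\mu u_k$. For a $2\times2$ matrix $O$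 let $|O))=(\mathrm{Tr}(O),\mathrm{Tr}(O\sigma_x),\mathrm{Tr}(O\sigma_y),\mathrm{Tr}(O\sigma_z))^T$, with $((O|$ its conjugate transpose. For $\sin\theta\neq0$ let $$A_k^{\mathbb 1}=N\begin{pmatrix}\frac1N&0\\0&m\,m^T\end{pmatrix},\quad m=\begin{pmatrix}\sin(k-\beta)\\-\cos(k-\beta)\\\cot\theta\,\sin(k-\alpha)\end{pmatrix},\quad N=\frac{\sin^2\theta}{1-\cos^2\theta\cos^2(k-\alpha)} .$$ Of the three coin parameters only $\theta$ and $\alpha$ can be estimated at the leading order $t^2$ of the QFI matrix for large $t$. Precisely: 1. If $\sin\theta\ne0$, then $A_k^{\mathbb 1}|O_\beta))=0$ for every $k\in\mathbb R$. 2. If $\sin\theta\ne0$, then for every initial state with momentum-space amplitude $\varphi_k(0)=\langle k|\Psi(0)\rangle$ (where $|k\rangle=\sum_x e^{ikx}|x\rangle$) and $\varrho_0=|\varphi_k(0)\rangle\langle\varphi_k(0)|$, and every $t\in\mathbb N$, all elements involving $\beta$ (that is, $\mu=\beta$ or $\nu=\beta$) of the large-time expression of the QFI matrix $$t^2\Big\{\int_{-\pi}^{\pi}\frac{dk}{2\pi}((O_\mu|A_k^{\mathbb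 1}|O_\nu))-\Big(\int_{-\pi}^{\pi}\frac{dk}{2\pi}((O_\mu|A_k^{\mathbb 1}|\varrho_0))\Big)\Big(\int_{-\pi}^{\pi}\frac{dk}{2\pi}((\varrho_0|A_k^{\mathbb 1}|O_\nu))\Big)\Big\}$$ vanish. 3. For every $\Theta$ and every initial state, $\Psi_\Theta(t)$ is differentiable in each parameter, and $\lim_{t\to\infty}F_{\mu\beta}(t)/t^2=\lim_{t\to\infty}F_{\beta\mu}(t)/t^2=0$ for every $\mu\in\{\theta,\alpha,\beta\}$. 4. There is an initial state such that, for all $\Theta$ with $\sin\theta\neq0$ and $\cos\theta\ne0$, the matrix $\frac1{t^2}\begin{pmatrix}F_{\theta\theta}&F_{\theta\alpha}\\F_{\alpha\theta}&F_{\alpha\alpha}\end{pmatrix}$ converges, as $t\to\infty$, to a positive definite matrix. -/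

import Mathlib

open scoped ENNReal

namespace QWalk

noncomputable section

/-- The three parameters of the coin operator. -/
inductive CoinParam
  | θ
  | α
  | β
  deriving DecidableEq

/-- A value `Θ = (θ, α, β)` of the coin parameters. -/
abbrev Params := CoinParam → ℝ

/-- The coin operator
`!![e^{iα} cos θ, e^{iβ} sin θ; -e^{-iβ} sin θ, e^{-iα} cos θ]`. -/
def coin (Θ : Params) : Matrix (Fin 2) (Fin 2) ℂ :=
  !![Complex.exp (Complex.I * (Θ .α : ℂ)) * (Real.cos (Θ .θ) : ℂ),
      Complex.exp (Complex.I * (Θ .β : ℂ)) * (Real.sin (Θ .θ) : ℂ);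
    -Complex.exp (-(Complex.I * (Θ .β : ℂ))) * (Real.sin (Θ .θ) : ℂ),
      Complex.exp (-(Complex.I * (Θ .α : ℂ))) * (Real.cos (Θ .θ) : ℂ)]

/-! The walk on position space. -/

/-- The Hilbert space `ℓ²(ℤ) ⊗ ℂ²` of lattice and coin, as `ℓ²(ℤ × {0, 1})`: the value of `ψ` at
`(x, j)` is the amplitude of `|x⟩ ⊗ |j⟩`. -/
abbrev WalkSpace : Type := lp (fun _ : ℤ × Fin 2 => ℂ) 2

/-- The amplitude of `|x⟩ ⊗ |j⟩` after a conditional shift is the amplitude before it at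
`shiftPerm (x, j)`, that is, at `(x - 1, 0)` if `j = 0` and at `(x + 1, 1)` if `j = 1`. -/
def shiftPerm : Equiv.Perm (ℤ × Fin 2) where
  toFun p := (if p.2 = 0 then p.1 - 1 else p.1 + 1, p.2)
  invFun p := (if p.2 = 0 then p.1 + 1 else p.1 - 1, p.2)
  left_inv p := by
    by_cases h : p.2 = 0 <;> ext <;> simp [h]
  right_inv p := by
    by_cases h : p.2 = 0 <;> ext <;> simp [h]

theorem memlp_iff (f : ℤ × Fin 2 → ℂ) :
    Memℓp f 2 ↔ Summable fun p => ‖f p‖ ^ 2 := by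
  rw [memℓp_gen_iff (by norm_num)]
  simp

theorem memlp_shift (ψ : WalkSpace) : Memℓp (fun p => ψ (shiftPerm p)) 2 := by
  have h := (memlp_iff (fun p => ψ p)).1 (lp.memℓp ψ)
  exact (memlp_iff _).2 (shiftPerm.summable_iff.2 h)

theorem memlp_comp_coin (ψ : WalkSpace) (l : Fin 2) :
    Memℓp (fun p : ℤ × Fin 2 => ψ (p.1, l)) 2 := by
  have h := (memlp_iff (fun p => ψ p)).1 (lp.memℓp ψ)
  have hl : Summable fun x : ℤ => ‖ψ (x, l)‖ ^ 2 :=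
    h.comp_injective (i := fun x : ℤ => (x, l)) (fun a b hab => congrArg Prod.fst hab)
  refine (memlp_iff _).2 ?_
  rw [← (Equiv.prodComm (Fin 2) ℤ).summable_iff]
  refine (summable_prod_of_nonneg (fun _ => sq_nonneg _)).2 ⟨fun _ => hl, ?_⟩
  exact (hasSum_fintype _).summable

theorem memlp_coin (C : Matrix (Fin 2) (Fin 2) ℂ) (ψ : WalkSpace) :
    Memℓp (fun p : ℤ × Fin 2 => ∑ l, C p.2 l * ψ (p.1, l)) 2 := by
  refine Memℓp.finsetSum (f := fun l (p : ℤ × Fin 2) => C p.2 l * ψ (p.1, l)) Finset.univ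
    fun l _ => ?_
  have h := (memlp_comp_coin ψ l).const_smul (‖C 0 l‖ + ‖C 1 l‖ : ℂ)
  refine h.mono' fun p => ?_
  obtain ⟨x, j⟩ := p
  have h0 : ‖(‖C 0 l‖ + ‖C 1 l‖ : ℂ)‖ = ‖C 0 l‖ + ‖C 1 l‖ := by
    rw [← Complex.ofReal_add, Complex.norm_real, Real.norm_of_nonneg (by positivity)]
  simp only [Pi.smul_apply, norm_smul, norm_mul, h0]
  refine mul_le_mul_of_nonneg_right ?_ (norm_nonneg _)
  fin_cases j
  · exact le_add_of_nonneg_right (norm_nonneg _)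
  · exact le_add_of_nonneg_left (norm_nonneg _)

/-- The conditional shift `S = ∑ₓ |x+1⟩⟨x| ⊗ |0⟩⟨0| + |x-1⟩⟨x| ⊗ |1⟩⟨1|`. -/
def shiftOp : WalkSpace →ₗ[ℂ] WalkSpace where
  toFun ψ := ⟨fun p => ψ (shiftPerm p), memlp_shift ψ⟩
  map_add' _ _ := rfl
  map_smul' _ _ := rfl

/-- The operator `𝟙 ⊗ C`. -/
def coinOp (C : Matrix (Fin 2) (Fin 2) ℂ) : WalkSpace →ₗ[ℂ] WalkSpace where
  toFun ψ := ⟨fun p => ∑ l, C p.2 l * ψ (p.1, l), memlp_coin C ψ⟩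
  map_add' ψ χ := by
    ext p
    change ∑ l, C p.2 l * (ψ (p.1, l) + χ (p.1, l)) =
      ∑ l, C p.2 l * ψ (p.1, l) + ∑ l, C p.2 l * χ (p.1, l)
    simp only [mul_add, Finset.sum_add_distrib]
  map_smul' c ψ := by
    ext p
    change ∑ l, C p.2 l * (c * ψ (p.1, l)) = c * ∑ l, C p.2 l * ψ (p.1, l)
    simp only [Finset.mul_sum, mul_left_comm]

/-- One step `U_Θ = S (𝟙 ⊗ C_Θ)` of the walk. -/
def stepOp (Θ : Params) : Module.End ℂ WalkSpace :=
  shiftOp ∘ₗ coinOp (coin Θ)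

/-- The state `|Ψ_Θ(t)⟩ = U_Θ ^ t |Ψ(0)⟩` after `t` steps. -/
def state (Ψ₀ : WalkSpace) (t : ℕ) (Θ : Params) : WalkSpace :=
  (stepOp Θ ^ t) Ψ₀

/-- The curve of states along which only the parameter `μ` varies. -/
def stateAlong (Ψ₀ : WalkSpace) (t : ℕ) (Θ : Params) (μ : CoinParam) (s : ℝ) : WalkSpace :=
  state Ψ₀ t (Function.update Θ μ s)

/-- The partial derivative `|∂_μ Ψ_Θ(t)⟩`, in the norm of the Hilbert space. -/
def dstate (Ψ₀ : WalkSpace) (t : ℕ) (Θ : Params) (μ : CoinParam) : WalkSpace :=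
  deriv (stateAlong Ψ₀ t Θ μ) (Θ μ)

/-- The element `F_{μν}` of the quantum Fisher information matrix of the pure-state model
`Θ ↦ |Ψ_Θ(t)⟩`:
`4 Re (⟨∂_μ Ψ|∂_ν Ψ⟩ - ⟨∂_μ Ψ|Ψ⟩ ⟨Ψ|∂_ν Ψ⟩)`. -/
def qfi (Ψ₀ : WalkSpace) (t : ℕ) (Θ : Params) (μ ν : CoinParam) : ℝ :=
  4 * (inner ℂ (dstate Ψ₀ t Θ μ) (dstate Ψ₀ t Θ ν)
    - inner ℂ (dstate Ψ₀ t Θ μ) (state Ψ₀ t Θ) * inner ℂ (state Ψ₀ t Θ) (dstate Ψ₀ t Θ ν)).re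

/-! The walk in momentum space. -/

/-- `u_k(Θ) = (e^{-ik} |0⟩⟨0| + e^{ik} |1⟩⟨1|) C_Θ`. -/
def stepK (k : ℝ) (Θ : Params) : Matrix (Fin 2) (Fin 2) ℂ :=
  !![Complex.exp (-(Complex.I * (k : ℂ))), 0; 0, Complex.exp (Complex.I * (k : ℂ))] * coin Θ

/-- `∂_μ u_k(Θ)`, entry by entry. -/
def dstepK (k : ℝ) (Θ : Params) (μ : CoinParam) : Matrix (Fin 2) (Fin 2) ℂ :=
  Matrix.of fun i j => deriv (fun s : ℝ => stepK k (Function.update Θ μ s) i j) (Θ μ)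

/-- `O_μ = u_k† ∂_μ u_k`. -/
def genO (k : ℝ) (Θ : Params) (μ : CoinParam) : Matrix (Fin 2) (Fin 2) ℂ :=
  (stepK k Θ).conjTranspose * dstepK k Θ μ

/-- The Pauli basis `𝟙, σ_x, σ_y, σ_z`. -/
def pauli : Fin 4 → Matrix (Fin 2) (Fin 2) ℂ :=
  ![1, !![0, 1; 1, 0], !![0, -Complex.I; Complex.I, 0], !![1, 0; 0, -1]]

/-- The four-component vector `|O))` of an operator `O` on the coin space, with components
`Tr (O σ_i)`. -/
def blochVec (O : Matrix (Fin 2) (Fin 2) ℂ) : Fin 4 → ℂ :=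
  fun i => (O * pauli i).trace

/-- `N = sin² θ / (1 - cos² θ cos² (k - α))`. -/
def normN (k : ℝ) (Θ : Params) : ℝ :=
  Real.sin (Θ .θ) ^ 2 / (1 - Real.cos (Θ .θ) ^ 2 * Real.cos (k - Θ .α) ^ 2)

/-- The matrix `A_k^𝟙` in real form. -/
def projAReal (k : ℝ) (Θ : Params) : Matrix (Fin 4) (Fin 4) ℝ :=
  normN k Θ •
    !![1 / normN k Θ, 0, 0, 0;
      0, Real.sin (k - Θ .β) ^ 2, -(Real.cos (k - Θ .β) * Real.sin (k - Θ .β)),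
        Real.cot (Θ .θ) * Real.sin (k - Θ .β) * Real.sin (k - Θ .α);
      0, -(Real.cos (k - Θ .β) * Real.sin (k - Θ .β)), Real.cos (k - Θ .β) ^ 2,
        -(Real.cot (Θ .θ) * Real.cos (k - Θ .β) * Real.sin (k - Θ .α));
      0, Real.cot (Θ .θ) * Real.sin (k - Θ .β) * Real.sin (k - Θ .α),
        -(Real.cot (Θ .θ) * Real.cos (k - Θ .β) * Real.sin (k - Θ .α)),
        Real.cot (Θ .θ) ^ 2 * Real.sin (k - Θ .α) ^ 2]

/-- The matrix `A_k^𝟙`, acting on four-component complex vectors. -/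
def projA (k : ℝ) (Θ : Params) : Matrix (Fin 4) (Fin 4) ℂ :=
  (projAReal k Θ).map Complex.ofReal

/-- `((v| A_k^𝟙 |w))`, where `((v|` is the conjugate transpose of `|v))`. -/
def sandwich (k : ℝ) (Θ : Params) (v w : Fin 4 → ℂ) : ℂ :=
  star v ⬝ᵥ (projA k Θ).mulVec w

/-- `φ k = ⟨k|Ψ₀⟩` is the momentum-space amplitude of `Ψ₀ ∈ ℓ²(ℤ) ⊗ ℂ²`: the square-integrable
function on `(-π, π]` with `Ψ₀ = (1 / 2π) ∫ |k⟩ ⊗ φ k dk`, where `|k⟩ = ∑ₓ e^{ikx} |x⟩`. -/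
def IsMomentumAmplitude (Ψ₀ : WalkSpace) (φ : ℝ → EuclideanSpace ℂ (Fin 2)) : Prop :=
  MeasureTheory.MemLp φ 2 (MeasureTheory.volume.restrict (Set.Ioc (-Real.pi) Real.pi)) ∧
    ∀ (x : ℤ) (j : Fin 2), Ψ₀ (x, j) =
      1 / (2 * (Real.pi : ℂ)) *
        ∫ k in (-Real.pi)..Real.pi, Complex.exp (Complex.I * (k : ℂ) * (x : ℂ)) * φ k j

/-- `ϱ₀ = |φ k⟩⟨φ k|`. -/
def rhoK (φ : ℝ → EuclideanSpace ℂ (Fin 2)) (k : ℝ) : Matrix (Fin 2) (Fin 2) ℂ :=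
  Matrix.of fun i j => φ k i * star (φ k j)

/-- The large-time (order `t²`) expression for the quantum Fisher information matrix:
`t² { ∫ dk/2π ((O_μ| A |O_ν)) - (∫ dk/2π ((O_μ| A |ϱ₀))) (∫ dk/2π ((ϱ₀| A |O_ν))) }`,
with `A = A_k^𝟙` and integrals over `[-π, π]`. -/
def qfiAsymp (φ : ℝ → EuclideanSpace ℂ (Fin 2)) (t : ℕ) (Θ : Params) (μ ν : CoinParam) : ℂ :=
  (t : ℂ) ^ 2 *
    ((1 / (2 * (Real.pi : ℂ)) * ∫ k in (-Real.pi)..Real.pi,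
        sandwich k Θ (blochVec (genO k Θ μ)) (blochVec (genO k Θ ν)))
      - (1 / (2 * (Real.pi : ℂ)) * ∫ k in (-Real.pi)..Real.pi,
          sandwich k Θ (blochVec (genO k Θ μ)) (blochVec (rhoK φ k)))
        * (1 / (2 * (Real.pi : ℂ)) * ∫ k in (-Real.pi)..Real.pi,
          sandwich k Θ (blochVec (rhoK φ k)) (blochVec (genO k Θ ν))))

end

end QWalk

/-!
Conjugated by `U ^ (-t)` and divided by `t`, the derivative `∂_μ (U ^ t Ψ₀)` is the time average
of the Heisenberg evolution of the generator `K_μ = C† ∂_μ C`, applied to `Ψ₀`; so `F_{μν}(t) / t²`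
is the Fisher form at `Ψ₀` of two such averages. The coin has the form `!![p, q; -q̄, p̄]`, hence
`U + U† = p T + p̄ T†` with `T` the lattice translation, which commutes with every `𝟙 ⊗ C`. For a
unitary `U` whose `U + U†` commutes with `K` and has norm less than `2`, `K` is the sum of the
conserved operator `(U - U†)⁻¹ (U K - K U†)`, the limit of its time averages, and a coboundary
`U† Y U - Y`, which averages to zero.

The parameter `β` is the angle of a rotation of the coin about the `z`-axis, which commutes with the
shift; so `K_β` is itself a coboundary, for every `θ`. In momentum space, `O_β` is for the same
reason a coboundary of `u_k`, hence trace-orthogonal to the commutant of `u_k`, onto which `A_k^𝟙`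
projects. For `θ` and `α`, the conserved parts are `(U - U†)⁻¹ ∂_μ (U + U†)`, and comparing the
amplitudes at `(-1, 1)` and `(1, 0)` of operators applied to `|0⟩ ⊗ |0⟩` shows that no real
combination of them maps this state to a multiple of itself.
-/

namespace QWalk

open Filter Topology

noncomputable section

section ConservedPart

variable {R : Type*} [Ring R]

/-- The part of `K` that commutes with the unit `u`, in the decomposition of `K` into such a part
and a coboundary `u⁻¹ * Y * u - Y`. The formula is meaningful when `u - u⁻¹` is invertible and
`u + u⁻¹` commutes with `K`. -/
def conservedPart (u : Rˣ) (K : R) : R :=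
  Ring.inverse (u - ↑u⁻¹ : R) * (u * K - K * ↑u⁻¹)

variable {u : Rˣ} {K : R}

theorem commute_sub_inv (u : Rˣ) : Commute (u : R) (u - ↑u⁻¹) :=
  (Commute.refl _).sub_right (Commute.units_inv_right (Commute.refl _))

theorem sub_inv_mul_conservedPart (hb : IsUnit (u - ↑u⁻¹ : R)) (K : R) :
    (u - ↑u⁻¹ : R) * conservedPart u K = u * K - K * ↑u⁻¹ :=
  Ring.mul_inverse_cancel_left _ _ hb

theorem commutator_eq_of_commute_add_inv (hK : Commute (u + ↑u⁻¹ : R) K) :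
    u * K - K * u = K * ↑u⁻¹ - ↑u⁻¹ * K := by
  rw [sub_eq_sub_iff_add_eq_add, add_comm (K * _), ← mul_add, ← add_mul, hK.eq]

theorem commute_conservedPart (hb : IsUnit (u - ↑u⁻¹ : R)) (hK : Commute (u + ↑u⁻¹ : R) K) :
    Commute (u : R) (conservedPart u K) := by
  have hC : u * K - K * ↑u⁻¹ = K * u - ↑u⁻¹ * K := by
    have h := commutator_eq_of_commute_add_inv hK
    rw [sub_eq_sub_iff_add_eq_add] at h ⊢
    rw [h, add_comm]
  have hcomm : (u : R) * (u * K - K * ↑u⁻¹) = (u * K - K * ↑u⁻¹) * u := calc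
    (u : R) * (u * K - K * ↑u⁻¹) = u * K * u - K := by
      rw [hC, mul_sub, Units.mul_inv_cancel_left, mul_assoc]
    _ = (u * K - K * ↑u⁻¹) * u := by rw [sub_mul, Units.inv_mul_cancel_right]
  refine hb.mul_left_cancel ?_
  rw [(commute_sub_inv u).symm.left_comm, ← mul_assoc _ _ (u : R),
    sub_inv_mul_conservedPart hb, hcomm]

theorem exists_eq_conservedPart_add_coboundary (hb : IsUnit (u - ↑u⁻¹ : R))
    (hK : Commute (u + ↑u⁻¹ : R) K) :
    ∃ Y, K = conservedPart u K + (↑u⁻¹ * Y * u - Y) := by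
  obtain ⟨b, hb'⟩ := hb
  have hub : Commute (↑u⁻¹ : R) ↑b⁻¹ :=
    (hb' ▸ commute_sub_inv u : Commute (u : R) b).units_inv_left.units_inv_right
  obtain ⟨D, hD⟩ : ∃ D, D = u * K - K * u := ⟨_, rfl⟩
  have hD' : D = K * ↑u⁻¹ - ↑u⁻¹ * K := hD.trans (commutator_eq_of_commute_add_inv hK)
  have hDu : ↑u⁻¹ * D = D * u := calc
    ↑u⁻¹ * D = K - ↑u⁻¹ * K * u := by rw [hD, mul_sub, Units.inv_mul_cancel_left, mul_assoc]
    _ = D * u := by rw [hD', sub_mul, Units.inv_mul_cancel_right]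
  have hsplit : (b : R) * K = (u * K - K * ↑u⁻¹) + D := by
    rw [hb', hD', sub_mul, sub_add_sub_cancel]
  refine ⟨↑b⁻¹ * D * ↑b⁻¹ * ↑u⁻¹, ?_⟩
  calc
    K = ↑b⁻¹ * (u * K - K * ↑u⁻¹) + ↑b⁻¹ * D * (b * ↑b⁻¹) := by
      rw [Units.mul_inv, mul_one, ← mul_add, ← hsplit, Units.inv_mul_cancel_left]
    _ = ↑b⁻¹ * (u * K - K * ↑u⁻¹) + (↑b⁻¹ * (D * u) * ↑b⁻¹ - ↑b⁻¹ * D * (↑u⁻¹ * ↑b⁻¹)) := by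
      rw [hb']; noncomm_ring
    _ = conservedPart u K + (↑u⁻¹ * (↑b⁻¹ * D * ↑b⁻¹ * ↑u⁻¹) * u - ↑b⁻¹ * D * ↑b⁻¹ * ↑u⁻¹) := by
      rw [conservedPart, ← hb', Ring.inverse_unit, ← hDu, hub.eq]
      simp only [mul_assoc, Units.inv_mul, mul_one, hub.left_comm]

end ConservedPart

section Average

variable {𝕜 E F : Type*} [RCLike 𝕜] [NormedAddCommGroup E] [NormedSpace 𝕜 E] [FunLike F E E] {f : F}

theorem norm_iterate_apply (hf : ∀ x, ‖f x‖ = ‖x‖) (n : ℕ) (x : E) : ‖f^[n] x‖ = ‖x‖ := by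
  induction n with
  | zero => rfl
  | succ n ih => rw [Function.iterate_succ_apply', hf, ih]

theorem norm_birkhoffAverage_id_le (hf : ∀ x, ‖f x‖ = ‖x‖) (n : ℕ) (x : E) :
    ‖birkhoffAverage 𝕜 f id n x‖ ≤ ‖x‖ := calc
  ‖birkhoffAverage 𝕜 f id n x‖ = (n : ℝ)⁻¹ * ‖birkhoffSum f id n x‖ := by
    rw [birkhoffAverage, norm_smul, norm_inv, RCLike.norm_natCast]
  _ ≤ (n : ℝ)⁻¹ * (n * ‖x‖) := by
    gcongr
    refine (norm_sum_le_of_le _ fun i _ => (norm_iterate_apply hf i x).le).trans_eq ?_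
    rw [Finset.sum_const, Finset.card_range, nsmul_eq_mul]
  _ ≤ ‖x‖ := inv_mul_le_of_le_mul₀ n.cast_nonneg (norm_nonneg x) le_rfl

theorem birkhoffAverage_id_add [AddMonoidHomClass F E E] (n : ℕ) (x y : E) :
    birkhoffAverage 𝕜 f id n (x + y) = birkhoffAverage 𝕜 f id n x + birkhoffAverage 𝕜 f id n y := by
  simp only [birkhoffAverage, birkhoffSum, iterate_map_add, id, Finset.sum_add_distrib, smul_add]

theorem tendsto_birkhoffAverage_fixedPt_add_coboundary [AddMonoidHomClass F E E]
    (hf : ∀ x, ‖f x‖ = ‖x‖) {l : E} (hl : f l = l) (y : E) :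
    Tendsto (birkhoffAverage 𝕜 f id · (l + (f y - y))) atTop (𝓝 l) := by
  have hbdd : Bornology.IsBounded (Set.range fun n => id (f^[n] y)) :=
    isBounded_iff_forall_norm_le.2
      ⟨‖y‖, Set.forall_mem_range.2 fun n => (norm_iterate_apply hf n y).le⟩
  have hsplit (n : ℕ) : birkhoffAverage 𝕜 f id n (l + (f y - y)) = birkhoffAverage 𝕜 f id n l +
      (birkhoffAverage 𝕜 f id n (f y) - birkhoffAverage 𝕜 f id n y) := by
    rw [birkhoffAverage_id_add, add_right_inj, eq_sub_iff_add_eq, ← birkhoffAverage_id_add,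
      sub_add_cancel]
  simpa only [hsplit, id, add_zero] using
    (Function.IsFixedPt.tendsto_birkhoffAverage 𝕜 hl id).add
      (tendsto_birkhoffAverage_apply_sub_birkhoffAverage 𝕜 hbdd)

end Average

section Heisenberg

variable {A : Type*} [CStarAlgebra A]

/-- The Heisenberg evolution `X ↦ u⋆ X u` under a unitary `u`. -/
def heisenberg (u : unitary A) : A ≃⋆ₐ[ℂ] A :=
  Unitary.conjStarAlgAut ℂ A (star u)

theorem heisenberg_apply (u : unitary A) (X : A) : heisenberg u X = star (u : A) * X * u :=
  Unitary.conjStarAlgAut_star_apply u X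

theorem heisenberg_eq_self_of_commute {u : unitary A} {X : A} (h : Commute (u : A) X) :
    heisenberg u X = X := by
  rw [heisenberg_apply, mul_assoc, ← h.eq, ← mul_assoc, Unitary.star_mul_self_of_mem u.2, one_mul]

theorem pow_mul_iterate_heisenberg (u : unitary A) (n : ℕ) (X : A) :
    (u : A) ^ n * (heisenberg u)^[n] X = X * (u : A) ^ n := by
  induction n with
  | zero => simp
  | succ n ih =>
    rw [Function.iterate_succ_apply', heisenberg_apply, pow_succ, mul_assoc _ (u : A),
      ← mul_assoc (u : A), ← mul_assoc (u : A), Unitary.mul_star_self_of_mem u.2, one_mul,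
      ← mul_assoc, ih, mul_assoc]

theorem norm_birkhoffAverage_heisenberg_le (u : unitary A) (n : ℕ) (X : A) :
    ‖birkhoffAverage ℂ (heisenberg u) id n X‖ ≤ ‖X‖ :=
  norm_birkhoffAverage_id_le (StarAlgEquiv.norm_map (heisenberg u)) n X

theorem tendsto_birkhoffAverage_coboundary (u : unitary A) (Y : A) :
    Tendsto (birkhoffAverage ℂ (heisenberg u) id · (star (u : A) * Y * u - Y)) atTop (𝓝 0) := by
  simpa only [heisenberg_apply, zero_add] using
    tendsto_birkhoffAverage_fixedPt_add_coboundary (𝕜 := ℂ)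
      (StarAlgEquiv.norm_map (heisenberg u)) (map_zero _) Y

theorem isUnit_sub_star {u : unitary A} (hu : ‖(u : A) + star (u : A)‖ < 2) :
    IsUnit ((u : A) - star (u : A)) := by
  set s : A := (1 / 2 : ℂ) • (u + star (u : A)) with hs
  have hsq : ((u : A) - star (u : A)) ^ 2 = (-4 : ℂ) • (1 - s ^ 2) := by
    have h4 : s ^ 2 = (1 / 4 : ℂ) • (u + star (u : A)) ^ 2 := by rw [hs, smul_pow]; norm_num
    have hadd : (u + star (u : A)) ^ 2 = (u - star (u : A)) ^ 2 + (4 : ℂ) • (1 : A) := by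
      simp only [sq, add_mul, mul_add, sub_mul, mul_sub, Unitary.star_mul_self_of_mem u.2,
        Unitary.mul_star_self_of_mem u.2]
      module
    rw [h4, hadd]
    module
  have hnorm : ‖s ^ 2‖ < 1 := by
    have hs1 : ‖s‖ < 1 := by
      rw [hs, norm_smul, norm_div, norm_one, Complex.norm_ofNat]
      linarith
    exact (norm_pow_le' s two_pos).trans_lt (pow_lt_one₀ (norm_nonneg s) hs1 two_ne_zero)
  rw [← isUnit_pow_iff two_ne_zero, hsq]
  exact (isUnit_one_sub_of_norm_lt_one hnorm).smul (Units.mk0 (-4 : ℂ) (by norm_num))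

theorem sub_star_mul_conservedPart {u : unitary A} (hu : ‖(u : A) + star (u : A)‖ < 2) (K : A) :
    ((u : A) - star (u : A)) * conservedPart (Unitary.toUnits u) K = u * K - K * star (u : A) :=
  sub_inv_mul_conservedPart (u := Unitary.toUnits u) (isUnit_sub_star hu) K

theorem tendsto_birkhoffAverage_conservedPart {u : unitary A} {K : A}
    (hu : ‖(u : A) + star (u : A)‖ < 2) (hK : Commute ((u : A) + star (u : A)) K) :
    Tendsto (birkhoffAverage ℂ (heisenberg u) id · K) atTop
      (𝓝 (conservedPart (Unitary.toUnits u) K)) := by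
  have hb : IsUnit (Unitary.toUnits u - ↑(Unitary.toUnits u)⁻¹ : A) := isUnit_sub_star hu
  obtain ⟨Y, hY⟩ := exists_eq_conservedPart_add_coboundary hb hK
  have hK' : K = conservedPart (Unitary.toUnits u) K + (heisenberg u Y - Y) := by
    rw [heisenberg_apply]
    exact hY
  have hlim := tendsto_birkhoffAverage_fixedPt_add_coboundary (𝕜 := ℂ)
    (StarAlgEquiv.norm_map (heisenberg u))
    (heisenberg_eq_self_of_commute (commute_conservedPart hb hK)) Y
  rwa [← hK'] at hlim

theorem hasDerivAt_pow_of_unitary {𝕜 : Type*} [NontriviallyNormedField 𝕜] [NormedAlgebra 𝕜 A]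
    {f : 𝕜 → A} {u : unitary A} {K : A} {s : 𝕜} (hu : f s = u) (hf : HasDerivAt f (u * K) s)
    (n : ℕ) :
    HasDerivAt (fun x => f x ^ n) ((u : A) ^ n * birkhoffSum (heisenberg u) id n K) s := by
  induction n with
  | zero => simpa using hasDerivAt_const s (1 : A)
  | succ n ih =>
    have hsum : (u : A) ^ (n + 1) * birkhoffSum (heisenberg u) id (n + 1) K =
        u * K * f s ^ n + f s * (u ^ n * birkhoffSum (heisenberg u) id n K) := by
      rw [birkhoffSum_succ, id, hu, mul_add, pow_succ', mul_assoc, mul_assoc _ _ (_^[n] _),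
        pow_mul_iterate_heisenberg, add_comm, mul_assoc]
    rw [hsum]
    simpa only [pow_succ'] using hf.fun_mul ih

end Heisenberg

section FisherForm

variable {H : Type*} [NormedAddCommGroup H] [InnerProductSpace ℂ H]

/-- The quantum Fisher information form at the pure state `ψ`, as a function of two derivatives
`v`, `w` of the state: `4 Re (⟨v|w⟩ - ⟨v|ψ⟩⟨ψ|w⟩)`. -/
def fisherForm (ψ v w : H) : ℝ :=
  4 * (inner ℂ v w - inner ℂ v ψ * inner ℂ ψ w).re

variable {ψ : H}

theorem fisherForm_map {H' : Type*} [NormedAddCommGroup H'] [InnerProductSpace ℂ H']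
    (f : H →ₗᵢ[ℂ] H') (ψ v w : H) : fisherForm (f ψ) (f v) (f w) = fisherForm ψ v w := by
  simp only [fisherForm, f.inner_map_map]

theorem fisherForm_smul_smul (ψ v w : H) (z : ℂ) :
    fisherForm ψ (z • v) (z • w) = ‖z‖ ^ 2 * fisherForm ψ v w := by
  have hz : starRingEnd ℂ z * z = ((‖z‖ ^ 2 : ℝ) : ℂ) := by
    rw [Complex.conj_mul', Complex.ofReal_pow]
  calc
    fisherForm ψ (z • v) (z • w) =
        4 * (starRingEnd ℂ z * z * (inner ℂ v w - inner ℂ v ψ * inner ℂ ψ w)).re := by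
      simp only [fisherForm, inner_smul_left, inner_smul_right]
      ring_nf
    _ = ‖z‖ ^ 2 * fisherForm ψ v w := by
      rw [hz, Complex.re_ofReal_mul, fisherForm, mul_left_comm]

theorem tendsto_fisherForm {ι : Type*} {l : Filter ι} (ψ : H) {v w : ι → H} {v₀ w₀ : H}
    (hv : Tendsto v l (𝓝 v₀)) (hw : Tendsto w l (𝓝 w₀)) :
    Tendsto (fun i => fisherForm ψ (v i) (w i)) l (𝓝 (fisherForm ψ v₀ w₀)) := by
  unfold fisherForm
  exact (Complex.continuous_re.tendsto _).comp ((hv.inner hw).sub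
    ((hv.inner tendsto_const_nhds).mul (tendsto_const_nhds.inner hw))) |>.const_mul 4

theorem fisherForm_eq_re_inner_starProjection (hψ : ‖ψ‖ = 1) (v w : H) :
    fisherForm ψ v w =
      4 * (inner ℂ ((ℂ ∙ ψ)ᗮ.starProjection v) ((ℂ ∙ ψ)ᗮ.starProjection w)).re := by
  rw [fisherForm, Submodule.inner_starProjection_left_eq_right,
    Submodule.starProjection_eq_self_iff.2 (Submodule.starProjection_apply_mem _ _),
    Submodule.starProjection_orthogonal_val,
    Submodule.starProjection_unit_singleton _ hψ, inner_sub_right, inner_smul_right,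
    mul_comm (inner ℂ v ψ)]

theorem abs_fisherForm_le (hψ : ‖ψ‖ = 1) (v w : H) : |fisherForm ψ v w| ≤ 4 * (‖v‖ * ‖w‖) := by
  rw [fisherForm_eq_re_inner_starProjection hψ, abs_mul, abs_of_pos (zero_lt_four' ℝ)]
  gcongr
  refine (Complex.abs_re_le_norm _).trans ((norm_inner_le_norm _ _).trans ?_)
  gcongr <;> exact Submodule.norm_starProjection_apply_le _ _

theorem fisherForm_comm (ψ v w : H) : fisherForm ψ v w = fisherForm ψ w v := by
  rw [fisherForm, ← Complex.conj_re, map_sub, map_mul, inner_conj_symm, inner_conj_symm,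
    inner_conj_symm, mul_comm (inner ℂ ψ v), fisherForm]

theorem tendsto_fisherForm_zero {ι : Type*} {l : Filter ι} (hψ : ‖ψ‖ = 1) {v w : ι → H} {C : ℝ}
    (hv : ∀ i, ‖v i‖ ≤ C) (hw : Tendsto w l (𝓝 0)) :
    Tendsto (fun i => fisherForm ψ (v i) (w i)) l (𝓝 0) := by
  refine squeeze_zero_norm (a := fun i => 4 * (C * ‖w i‖)) (fun i => ?_) ?_
  · refine (abs_fisherForm_le hψ _ _).trans ?_
    gcongr
    exact hv i
  · simpa using (hw.norm.const_mul C).const_mul 4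

theorem posDef_fisherForm {ι : Type*} [Fintype ι] (hψ : ‖ψ‖ = 1) {v : ι → H}
    (hv : ∀ (a : ι → ℝ) (c : ℂ), ∑ i, (a i : ℂ) • v i = c • ψ → a = 0) :
    (Matrix.of fun i j => fisherForm ψ (v i) (v j)).PosDef := by
  let _ : InnerProductSpace ℝ H := InnerProductSpace.rclikeToReal ℂ H
  set P := (ℂ ∙ ψ)ᗮ.starProjection
  have hgram : (Matrix.of fun i j => fisherForm ψ (v i) (v j)) =
      (4 : ℝ) • Matrix.gram ℝ fun i => P (v i) :=
    Matrix.ext fun _ _ => fisherForm_eq_re_inner_starProjection hψ _ _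
  have hindep : LinearIndependent ℝ fun i => P (v i) := by
    rw [Fintype.linearIndependent_iff]
    intro a ha
    have hker : P (∑ i, (a i : ℂ) • v i) = 0 := by
      rw [map_sum, ← ha]
      exact Finset.sum_congr rfl fun i _ => map_smul P _ _
    obtain ⟨c, hc⟩ := Submodule.mem_span_singleton.1 <|
      (ℂ ∙ ψ).orthogonal_orthogonal ▸ (Submodule.starProjection_apply_eq_zero_iff _).1 hker
    exact congrFun (hv a c hc.symm)
  rw [hgram]
  exact (Matrix.posDef_gram_of_linearIndependent hindep).smul four_pos

end FisherForm

section LatticeOperators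

/-- The unitary operator on `ℓ²(ι)` that permutes the standard basis by `e⁻¹`: on amplitudes it is
composition with `e`. -/
def permUnitary {ι : Type*} (e : Equiv.Perm ι) :
    unitary (lp (fun _ : ι => ℂ) 2 →L[ℂ] lp (fun _ : ι => ℂ) 2) :=
  have hmem (e : Equiv.Perm ι) (ψ : lp (fun _ : ι => ℂ) 2) : Memℓp (fun i => ψ (e i)) 2 :=
    (memℓp_gen_iff (by norm_num)).2 <|
      e.summable_iff.2 <| (memℓp_gen_iff (by norm_num)).1 (lp.memℓp ψ)
  Unitary.linearIsometryEquiv.symm <| LinearEquiv.isometryOfInner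
    { toFun := fun ψ => ⟨fun i => ψ (e i), hmem e ψ⟩
      invFun := fun ψ => ⟨fun i => ψ (e.symm i), hmem e.symm ψ⟩
      map_add' := fun _ _ => rfl
      map_smul' := fun _ _ => rfl
      left_inv := fun ψ => lp.ext <| funext fun i => congrArg ψ (e.apply_symm_apply i)
      right_inv := fun ψ => lp.ext <| funext fun i => congrArg ψ (e.symm_apply_apply i) }
    fun ψ χ => by
      rw [lp.inner_eq_tsum, lp.inner_eq_tsum]
      exact e.tsum_eq fun i => inner ℂ (ψ i) (χ i)

theorem star_permUnitary {ι : Type*} (e : Equiv.Perm ι) :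
    star (permUnitary e) = permUnitary e.symm :=
  (map_inv Unitary.linearIsometryEquiv.symm _).symm

theorem walkSpace_ext {ψ χ : WalkSpace} (h0 : ∀ x, ψ (x, 0) = χ (x, 0))
    (h1 : ∀ x, ψ (x, 1) = χ (x, 1)) : ψ = χ :=
  lp.ext <| funext <| Prod.forall.2 fun x => Fin.forall_fin_two.2 ⟨h0 x, h1 x⟩

theorem coinOp_apply (C : Matrix (Fin 2) (Fin 2) ℂ) (ψ : WalkSpace) (x : ℤ) (j : Fin 2) :
    coinOp C ψ (x, j) = C j 0 * ψ (x, 0) + C j 1 * ψ (x, 1) :=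
  Fin.sum_univ_two fun l => C j l * ψ (x, l)

theorem continuous_coinOp (C : Matrix (Fin 2) (Fin 2) ℂ) : Continuous (coinOp C) := by
  have hcoord (p : ℤ × Fin 2) : Continuous fun ψ : WalkSpace => ψ p :=
    (lp.evalCLM ℂ (fun _ : ℤ × Fin 2 => ℂ) 2 p).continuous
  refine LinearMap.continuous_of_seq_closed_graph _ fun u ψ χ hu hχ => lp.ext <| funext fun p => ?_
  refine tendsto_nhds_unique (((hcoord p).tendsto χ).comp hχ) ?_
  exact tendsto_finsetSum Finset.univ fun l _ =>
    (((hcoord (p.1, l)).tendsto ψ).comp hu).const_mul (C p.2 l)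

theorem inner_walkSpace (ψ χ : WalkSpace) :
    inner ℂ ψ χ = ∑' x, (inner ℂ (ψ (x, 0)) (χ (x, 0)) + inner ℂ (ψ (x, 1)) (χ (x, 1))) := by
  have hs : Summable fun p : ℤ × Fin 2 => (inner ℂ (ψ p) (χ p) : ℂ) :=
    (lp.hasSum_inner ψ χ).summable
  rw [lp.inner_eq_tsum, hs.tsum_prod]
  simp only [tsum_fintype, Fin.sum_univ_two]

theorem inner_coinOp_conjTranspose_left (C : Matrix (Fin 2) (Fin 2) ℂ) (ψ χ : WalkSpace) :
    inner ℂ (coinOp C.conjTranspose ψ) χ = inner ℂ ψ (coinOp C χ) := by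
  rw [inner_walkSpace, inner_walkSpace]
  refine tsum_congr fun x => ?_
  simp only [coinOp_apply, RCLike.inner_apply, map_add, map_mul, Matrix.conjTranspose_apply,
    RCLike.star_def, RCLike.conj_conj]
  ring

/-- The `⋆`-homomorphism `C ↦ 𝟙 ⊗ C` from coin matrices to bounded operators on
`ℓ²(ℤ) ⊗ ℂ²`. -/
def coinHom : Matrix (Fin 2) (Fin 2) ℂ →⋆ₐ[ℂ] (WalkSpace →L[ℂ] WalkSpace) where
  toFun C := ⟨coinOp C, continuous_coinOp C⟩
  map_one' := ContinuousLinearMap.ext fun ψ => walkSpace_ext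
    (fun x => by simp [coinOp_apply]) fun x => by simp [coinOp_apply]
  map_mul' C D := ContinuousLinearMap.ext fun ψ => walkSpace_ext
    (fun x => by
      simp only [ContinuousLinearMap.coe_mk', coinOp_apply, Matrix.mul_apply, Fin.sum_univ_two,
        mul_apply_eq_comp]
      ring)
    fun x => by
      simp only [ContinuousLinearMap.coe_mk', coinOp_apply, Matrix.mul_apply, Fin.sum_univ_two,
        mul_apply_eq_comp]
      ring
  map_zero' := ContinuousLinearMap.ext fun ψ => walkSpace_ext
    (fun x => by simp [coinOp_apply]) fun x => by simp [coinOp_apply]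
  map_add' C D := ContinuousLinearMap.ext fun ψ => walkSpace_ext
    (fun x => by
      simp only [ContinuousLinearMap.coe_mk', coinOp_apply, Matrix.add_apply, add_apply,
        AddSubgroup.coe_add, PreLp.add_apply]
      ring)
    fun x => by
      simp only [ContinuousLinearMap.coe_mk', coinOp_apply, Matrix.add_apply, add_apply,
        AddSubgroup.coe_add, PreLp.add_apply]
      ring
  commutes' c := ContinuousLinearMap.ext fun ψ => walkSpace_ext
    (fun x => by simp [coinOp_apply, Algebra.algebraMap_eq_smul_one])
    fun x => by simp [coinOp_apply, Algebra.algebraMap_eq_smul_one]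
  map_star' C := (ContinuousLinearMap.eq_adjoint_iff _ _).2 (inner_coinOp_conjTranspose_left C)

theorem coinHom_apply (C : Matrix (Fin 2) (Fin 2) ℂ) (ψ : WalkSpace) (x : ℤ) (j : Fin 2) :
    coinHom C ψ (x, j) = C j 0 * ψ (x, 0) + C j 1 * ψ (x, 1) :=
  coinOp_apply C ψ x j

theorem hasDerivAt_linearMap_matrix {m n E : Type*} [Finite m] [Finite n]
    [NormedAddCommGroup E] [NormedSpace ℂ E] (f : Matrix m n ℂ →ₗ[ℂ] E)
    {C : ℝ → Matrix m n ℂ} {D : Matrix m n ℂ} {s : ℝ}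
    (h : ∀ i j, HasDerivAt (fun x => C x i j) (D i j) s) :
    HasDerivAt (fun x => f (C x)) (f D) s := by
  classical
  have := Fintype.ofFinite m
  have := Fintype.ofFinite n
  have hf (M : Matrix m n ℂ) : f M = ∑ i, ∑ j, M i j • f (Matrix.single i j 1) := by
    conv_lhs => rw [Matrix.matrix_eq_sum_single M]
    simp only [map_sum, ← map_smul, Matrix.smul_single, smul_eq_mul, mul_one]
  rw [hf, funext fun x => hf (C x)]
  exact HasDerivAt.fun_sum fun i _ => HasDerivAt.fun_sum fun j _ => (h i j).smul_const _

end LatticeOperators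

section Coin

open Complex (I)

/-- The matrix of the quaternion `p + q j`. The coin, its derivatives and the momentum-space steps
of the walk all have this form. -/
def quatMatrix (p q : ℂ) : Matrix (Fin 2) (Fin 2) ℂ :=
  !![p, q; -star q, star p]

theorem star_quatMatrix (p q : ℂ) : star (quatMatrix p q) = quatMatrix (star p) (-q) := by
  ext i j
  fin_cases i <;> fin_cases j <;> simp [quatMatrix, Matrix.star_apply]

theorem quatMatrix_add (p q p' q' : ℂ) :
    quatMatrix p q + quatMatrix p' q' = quatMatrix (p + p') (q + q') := by
  ext i j
  fin_cases i <;> fin_cases j <;> simp [quatMatrix, add_comm]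

theorem ofReal_smul_quatMatrix (r : ℝ) (p q : ℂ) :
    (r : ℂ) • quatMatrix p q = quatMatrix (r * p) (r * q) := by
  ext i j
  fin_cases i <;> fin_cases j <;> simp [quatMatrix]

theorem quatMatrix_mul (p q p' q' : ℂ) :
    quatMatrix p q * quatMatrix p' q' =
      quatMatrix (p * p' - q * star q') (p * q' + q * star p') := by
  simp only [quatMatrix, Matrix.mul_fin_two, star_sub, star_add, star_mul', star_star]
  ring_nf

theorem quatMatrix_one_zero : quatMatrix 1 0 = 1 := by
  ext i j
  fin_cases i <;> fin_cases j <;> simp [quatMatrix]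

theorem hasDerivAt_quatMatrix {p q : ℝ → ℂ} {p' q' : ℂ} {s : ℝ} (hp : HasDerivAt p p' s)
    (hq : HasDerivAt q q' s) (i j : Fin 2) :
    HasDerivAt (fun x => quatMatrix (p x) (q x) i j) (quatMatrix p' q' i j) s := by
  fin_cases i <;> fin_cases j
  exacts [hp, hq, hq.star.fun_neg, hp.star]

theorem star_exp_I_mul (x : ℝ) : star (Complex.exp (I * x)) = Complex.exp (-(I * x)) := by
  rw [Complex.star_def, ← Complex.exp_conj, map_mul, Complex.conj_I, Complex.conj_ofReal, neg_mul]

theorem star_exp_I_mul_self_mul (x : ℝ) :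
    star (Complex.exp (I * x)) * Complex.exp (I * x) = 1 := by
  rw [star_exp_I_mul, ← Complex.exp_add, neg_add_cancel, Complex.exp_zero]

theorem hasDerivAt_exp_I_mul (x : ℝ) :
    HasDerivAt (fun s : ℝ => Complex.exp (I * s)) (I * Complex.exp (I * x)) x := by
  simpa [mul_comm] using ((hasDerivAt_id x).ofReal_comp.const_mul I).cexp

theorem coin_eq_quatMatrix (Θ : Params) :
    coin Θ = quatMatrix (Complex.exp (I * Θ .α) * Real.cos (Θ .θ))
      (Complex.exp (I * Θ .β) * Real.sin (Θ .θ)) := by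
  simp only [coin, quatMatrix, star_mul', star_exp_I_mul, Complex.star_def, Complex.conj_ofReal,
    neg_mul]

/-- The partial derivatives `∂_μ C_Θ` of the coin. -/
def coinDeriv (Θ : Params) : CoinParam → Matrix (Fin 2) (Fin 2) ℂ
  | .θ => quatMatrix (Complex.exp (I * Θ .α) * -Real.sin (Θ .θ))
      (Complex.exp (I * Θ .β) * Real.cos (Θ .θ))
  | .α => quatMatrix (I * Complex.exp (I * Θ .α) * Real.cos (Θ .θ)) 0
  | .β => quatMatrix 0 (I * Complex.exp (I * Θ .β) * Real.sin (Θ .θ))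

theorem hasDerivAt_coin (Θ : Params) (μ : CoinParam) (i j : Fin 2) :
    HasDerivAt (fun s => coin (Function.update Θ μ s) i j) (coinDeriv Θ μ i j) (Θ μ) := by
  simp only [coin_eq_quatMatrix]
  cases μ
  · refine hasDerivAt_quatMatrix ?_ ?_ i j
    · simpa using (Real.hasDerivAt_cos (Θ .θ)).ofReal_comp.const_mul (Complex.exp (I * Θ .α))
    · simpa using (Real.hasDerivAt_sin (Θ .θ)).ofReal_comp.const_mul (Complex.exp (I * Θ .β))
  · refine hasDerivAt_quatMatrix ?_ ?_ i j
    · simpa using (hasDerivAt_exp_I_mul (Θ .α)).mul_const (Real.cos (Θ .θ) : ℂ)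
    · simpa using hasDerivAt_const _ _
  · refine hasDerivAt_quatMatrix ?_ ?_ i j
    · simpa using hasDerivAt_const _ _
    · simpa using (hasDerivAt_exp_I_mul (Θ .β)).mul_const (Real.sin (Θ .θ) : ℂ)

theorem star_coin_mul_coin (Θ : Params) : star (coin Θ) * coin Θ = 1 := by
  have hα := star_exp_I_mul_self_mul (Θ .α)
  have hβ := star_exp_I_mul_self_mul (Θ .β)
  have hθ : (Real.sin (Θ .θ) : ℂ) ^ 2 + (Real.cos (Θ .θ) : ℂ) ^ 2 = 1 := by
    exact_mod_cast Real.sin_sq_add_cos_sq (Θ .θ)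
  rw [coin_eq_quatMatrix, star_quatMatrix, quatMatrix_mul, ← quatMatrix_one_zero]
  simp only [star_mul', Complex.star_def, Complex.conj_ofReal] at hα hβ ⊢
  congr 1
  · linear_combination (Real.cos (Θ .θ) : ℂ) ^ 2 * hα + (Real.sin (Θ .θ) : ℂ) ^ 2 * hβ + hθ
  · ring

theorem coin_mem_unitary (Θ : Params) : coin Θ ∈ unitary (Matrix (Fin 2) (Fin 2) ℂ) :=
  Unitary.mem_iff.2 ⟨star_coin_mul_coin Θ, mul_eq_one_comm.1 (star_coin_mul_coin Θ)⟩

/-- The generator `C_Θ† ∂_μ C_Θ` of the coin. -/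
def coinGen (Θ : Params) (μ : CoinParam) : Matrix (Fin 2) (Fin 2) ℂ :=
  star (coin Θ) * coinDeriv Θ μ

theorem coin_mul_coinGen (Θ : Params) (μ : CoinParam) : coin Θ * coinGen Θ μ = coinDeriv Θ μ := by
  rw [coinGen, ← mul_assoc, Unitary.mul_star_self_of_mem (coin_mem_unitary Θ), one_mul]

theorem star_coinGen (Θ : Params) (μ : CoinParam) : star (coinGen Θ μ) = -coinGen Θ μ := by
  have hα := star_exp_I_mul_self_mul (Θ .α)
  have hβ := star_exp_I_mul_self_mul (Θ .β)
  have hzero : quatMatrix 0 0 = 0 := by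
    ext i j
    fin_cases i <;> fin_cases j <;> simp [quatMatrix]
  rw [eq_neg_iff_add_eq_zero, coinGen, star_mul, star_star, coin_eq_quatMatrix, ← hzero]
  simp only [Complex.star_def] at hα hβ
  cases μ <;>
    simp only [coinDeriv, star_quatMatrix, quatMatrix_mul, quatMatrix_add, star_mul', star_neg,
      star_zero, Complex.star_def, Complex.conj_ofReal, Complex.conj_I] <;>
    congr 1
  · linear_combination (2 * Real.cos (Θ .θ) * Real.sin (Θ .θ) : ℂ) * (hβ - hα)
  all_goals ring

/-- The generator of the rotations of the coin about the `z`-axis. -/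
def coinZ : Matrix (Fin 2) (Fin 2) ℂ :=
  quatMatrix (I / 2) 0

theorem coinDeriv_β (Θ : Params) : coinDeriv Θ .β = coinZ * coin Θ - coin Θ * coinZ := by
  rw [eq_sub_iff_add_eq, coin_eq_quatMatrix, coinDeriv, coinZ, quatMatrix_mul, quatMatrix_mul,
    quatMatrix_add]
  congr 1
  · simp only [star_zero, mul_zero, sub_zero, zero_add]
    ring
  · simp only [star_div₀, Complex.star_def, Complex.conj_I, star_ofNat, mul_zero, zero_mul,
      zero_add, add_zero]
    ring

theorem coinGen_β (Θ : Params) : coinGen Θ .β = star (coin Θ) * coinZ * coin Θ - coinZ := by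
  rw [coinGen, coinDeriv_β, mul_sub, mul_assoc, ← mul_assoc (star _) (coin Θ), star_coin_mul_coin,
    one_mul]

end Coin

section Walk

variable (Θ : Params)

/-- The conditional shift `S`, as a unitary operator. -/
def shiftUnitary : unitary (WalkSpace →L[ℂ] WalkSpace) :=
  permUnitary shiftPerm

/-- The translation of the lattice by one site. -/
def translation : unitary (WalkSpace →L[ℂ] WalkSpace) :=
  permUnitary ((Equiv.subRight 1).prodCongr (Equiv.refl _))

/-- The step `U_Θ` of the walk, as a unitary operator. -/
def stepUnitary : unitary (WalkSpace →L[ℂ] WalkSpace) :=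
  shiftUnitary * ⟨coinHom (coin Θ), Unitary.map_mem coinHom (coin_mem_unitary Θ)⟩

theorem coe_stepUnitary : (stepUnitary Θ).1 = shiftUnitary.1 * coinHom (coin Θ) := rfl

theorem shiftUnitary_apply_zero (ψ : WalkSpace) (x : ℤ) : shiftUnitary.1 ψ (x, 0) = ψ (x - 1, 0) :=
  rfl

theorem shiftUnitary_apply_one (ψ : WalkSpace) (x : ℤ) : shiftUnitary.1 ψ (x, 1) = ψ (x + 1, 1) :=
  rfl

theorem star_shiftUnitary_apply_zero (ψ : WalkSpace) (x : ℤ) :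
    star shiftUnitary.1 ψ (x, 0) = ψ (x + 1, 0) := by
  rw [shiftUnitary, ← Unitary.coe_star, star_permUnitary]
  rfl

theorem star_shiftUnitary_apply_one (ψ : WalkSpace) (x : ℤ) :
    star shiftUnitary.1 ψ (x, 1) = ψ (x - 1, 1) := by
  rw [shiftUnitary, ← Unitary.coe_star, star_permUnitary]
  rfl

theorem translation_apply (ψ : WalkSpace) (x : ℤ) (j : Fin 2) :
    translation.1 ψ (x, j) = ψ (x - 1, j) := rfl

theorem star_translation_apply (ψ : WalkSpace) (x : ℤ) (j : Fin 2) :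
    star translation.1 ψ (x, j) = ψ (x + 1, j) := by
  rw [translation, ← Unitary.coe_star, star_permUnitary]
  rfl

theorem commute_translation_coinHom (C : Matrix (Fin 2) (Fin 2) ℂ) :
    Commute translation.1 (coinHom C) :=
  ContinuousLinearMap.ext fun ψ => lp.ext <| funext fun ⟨x, j⟩ => by
    simp only [mul_apply_eq_comp, translation_apply, coinHom_apply]

theorem commute_star_translation_coinHom (C : Matrix (Fin 2) (Fin 2) ℂ) :
    Commute (star translation.1) (coinHom C) :=
  ContinuousLinearMap.ext fun ψ => lp.ext <| funext fun ⟨x, j⟩ => by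
    simp only [mul_apply_eq_comp, star_translation_apply, coinHom_apply]

theorem coinHom_quatMatrix_apply_zero (p q : ℂ) (ψ : WalkSpace) (x : ℤ) :
    coinHom (quatMatrix p q) ψ (x, 0) = p * ψ (x, 0) + q * ψ (x, 1) :=
  coinHom_apply _ ψ x 0

theorem coinHom_quatMatrix_apply_one (p q : ℂ) (ψ : WalkSpace) (x : ℤ) :
    coinHom (quatMatrix p q) ψ (x, 1) = -star q * ψ (x, 0) + star p * ψ (x, 1) :=
  coinHom_apply _ ψ x 1

theorem commute_shiftUnitary_coinZ : Commute shiftUnitary.1 (coinHom coinZ) :=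
  ContinuousLinearMap.ext fun ψ => walkSpace_ext
    (fun x => by
      simp only [coinZ, mul_apply_eq_comp, shiftUnitary_apply_zero, coinHom_quatMatrix_apply_zero,
        zero_mul])
    fun x => by
      simp only [coinZ, mul_apply_eq_comp, shiftUnitary_apply_one, coinHom_quatMatrix_apply_one,
        star_zero, neg_zero, zero_mul]

theorem smul_translation_add_star_apply (p : ℂ) (ψ : WalkSpace) (x : ℤ) (j : Fin 2) :
    (p • translation.1 + star p • star translation.1) ψ (x, j) =
      p * ψ (x - 1, j) + star p * ψ (x + 1, j) := by
  rw [← star_translation_apply]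
  rfl

theorem shiftUnitary_mul_coinHom_quatMatrix_add_star (p q : ℂ) :
    shiftUnitary.1 * coinHom (quatMatrix p q) + star (shiftUnitary.1 * coinHom (quatMatrix p q)) =
      p • translation.1 + star p • star translation.1 := by
  rw [star_mul, ← map_star, star_quatMatrix]
  refine ContinuousLinearMap.ext fun ψ => walkSpace_ext (fun x => ?_) fun x => ?_
  · rw [smul_translation_add_star_apply]
    simp only [add_apply, AddSubgroup.coe_add, PreLp.add_apply, mul_apply_eq_comp,
      shiftUnitary_apply_zero, star_shiftUnitary_apply_zero,
      star_shiftUnitary_apply_one, coinHom_quatMatrix_apply_zero]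
    ring
  · rw [smul_translation_add_star_apply]
    simp only [add_apply, AddSubgroup.coe_add, PreLp.add_apply, mul_apply_eq_comp,
      shiftUnitary_apply_one, star_shiftUnitary_apply_zero,
      star_shiftUnitary_apply_one, coinHom_quatMatrix_apply_one, star_neg, star_star]
    ring

theorem stepUnitary_add_star : (stepUnitary Θ).1 + star (stepUnitary Θ).1 =
    coin Θ 0 0 • translation.1 + star (coin Θ 0 0) • star translation.1 := by
  rw [coe_stepUnitary, coin_eq_quatMatrix, shiftUnitary_mul_coinHom_quatMatrix_add_star]
  rfl

theorem norm_stepUnitary_add_star_lt {Θ : Params} (hs : Real.sin (Θ .θ) ≠ 0) :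
    ‖(stepUnitary Θ).1 + star (stepUnitary Θ).1‖ < 2 := by
  have hcos : |Real.cos (Θ .θ)| < 1 := by
    rw [← sq_lt_one_iff_abs_lt_one, ← Real.cos_sq_add_sin_sq (Θ .θ)]
    exact lt_add_of_pos_right _ (by positivity)
  have hp : ‖coin Θ 0 0‖ = |Real.cos (Θ .θ)| := by
    rw [coin_eq_quatMatrix]
    simp [quatMatrix, Complex.norm_exp, -Complex.ofReal_cos]
  have hT : ‖translation.1‖ ≤ 1 := by
    rw [← mul_one translation.1, CStarRing.norm_coe_unitary_mul]
    exact ContinuousLinearMap.norm_id_le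
  calc
    _ ≤ ‖coin Θ 0 0‖ * ‖translation.1‖ + ‖coin Θ 0 0‖ * ‖translation.1‖ := by
      rw [stepUnitary_add_star]
      refine (norm_add_le _ _).trans_eq ?_
      rw [norm_smul, norm_smul, norm_star (coin Θ 0 0), norm_star translation.1]
    _ ≤ |Real.cos (Θ .θ)| * 1 + |Real.cos (Θ .θ)| * 1 := by rw [hp]; gcongr
    _ < 2 := by linarith

theorem commute_stepUnitary_add_star_coinHom (C : Matrix (Fin 2) (Fin 2) ℂ) :
    Commute ((stepUnitary Θ).1 + star (stepUnitary Θ).1) (coinHom C) := by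
  rw [stepUnitary_add_star]
  exact ((commute_translation_coinHom C).smul_left _).add_left
    ((commute_star_translation_coinHom C).smul_left _)

theorem coinHom_coinGen_β : coinHom (coinGen Θ .β) =
    star (stepUnitary Θ).1 * coinHom coinZ * (stepUnitary Θ).1 - coinHom coinZ := by
  have hS : star shiftUnitary.1 * coinHom coinZ * shiftUnitary.1 = coinHom coinZ := by
    rw [mul_assoc, ← commute_shiftUnitary_coinZ.eq, ← mul_assoc,
      Unitary.star_mul_self_of_mem shiftUnitary.2, one_mul]
  calc
    coinHom (coinGen Θ .β) =
        coinHom (star (coin Θ)) * (star shiftUnitary.1 * coinHom coinZ * shiftUnitary.1) *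
          coinHom (coin Θ) - coinHom coinZ := by
      rw [hS, coinGen_β, map_sub, map_mul, map_mul]
    _ = star (stepUnitary Θ).1 * coinHom coinZ * (stepUnitary Θ).1 - coinHom coinZ := by
      simp only [coe_stepUnitary, star_mul, map_star, mul_assoc]

theorem hasDerivAt_stepUnitary (μ : CoinParam) :
    HasDerivAt (fun s => (stepUnitary (Function.update Θ μ s)).1)
      ((stepUnitary Θ).1 * coinHom (coinGen Θ μ)) (Θ μ) := by
  rw [coe_stepUnitary, mul_assoc, ← map_mul, coin_mul_coinGen]
  exact (hasDerivAt_linearMap_matrix (coinHom.toAlgHom.toLinearMap)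
    (hasDerivAt_coin Θ μ)).const_mul shiftUnitary.1

theorem state_eq_stepUnitary_pow (Ψ₀ : WalkSpace) (t : ℕ) :
    state Ψ₀ t Θ = ((stepUnitary Θ).1 ^ t) Ψ₀ := by
  induction t with
  | zero => rfl
  | succ t ih =>
    rw [state, pow_succ', Module.End.mul_apply, pow_succ', mul_apply_eq_comp, ← ih]
    rfl

theorem hasDerivAt_stateAlong (Ψ₀ : WalkSpace) (t : ℕ) (μ : CoinParam) :
    HasDerivAt (stateAlong Ψ₀ t Θ μ) (((stepUnitary Θ).1 ^ t)
      (birkhoffSum (heisenberg (stepUnitary Θ)) id t (coinHom (coinGen Θ μ)) Ψ₀)) (Θ μ) := by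
  have hpow := hasDerivAt_pow_of_unitary
    (f := fun s => (stepUnitary (Function.update Θ μ s)).1) (u := stepUnitary Θ)
    (by rw [Function.update_eq_self])
    (hasDerivAt_stepUnitary Θ μ) t
  refine (((ContinuousLinearMap.apply ℂ WalkSpace Ψ₀).restrictScalars ℝ).hasFDerivAt.comp_hasDerivAt
    (Θ μ) hpow).congr_of_eventuallyEq (Eventually.of_forall fun s => ?_)
  exact state_eq_stepUnitary_pow _ Ψ₀ t

/-- The tangent vector `U† ^ t ∂_μ (U ^ t Ψ₀) / t` in the Heisenberg picture, where it is the time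
average of the generator `C† ∂_μ C`. -/
def meanTangent (Ψ₀ : WalkSpace) (μ : CoinParam) (t : ℕ) : WalkSpace :=
  birkhoffAverage ℂ (heisenberg (stepUnitary Θ)) id t (coinHom (coinGen Θ μ)) Ψ₀

theorem qfi_div_sq (Ψ₀ : WalkSpace) (t : ℕ) (μ ν : CoinParam) :
    qfi Ψ₀ t Θ μ ν / (t : ℝ) ^ 2 =
      fisherForm Ψ₀ (meanTangent Θ Ψ₀ μ t) (meanTangent Θ Ψ₀ ν t) := by
  set G := fun μ => birkhoffSum (heisenberg (stepUnitary Θ)) id t (coinHom (coinGen Θ μ)) Ψ₀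
  have hqfi : qfi Ψ₀ t Θ μ ν = fisherForm Ψ₀ (G μ) (G ν) := by
    have h := fisherForm_map (Unitary.linearIsometryEquiv (stepUnitary Θ ^ t)).toLinearIsometry
      Ψ₀ (G μ) (G ν)
    rw [← h, qfi, dstate, dstate, (hasDerivAt_stateAlong Θ Ψ₀ t μ).deriv,
      (hasDerivAt_stateAlong Θ Ψ₀ t ν).deriv, state_eq_stepUnitary_pow]
    rfl
  calc
    _ = ‖(t : ℂ)⁻¹‖ ^ 2 * fisherForm Ψ₀ (G μ) (G ν) := by
      rw [hqfi, norm_inv, Complex.norm_natCast, inv_pow, div_eq_inv_mul]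
    _ = _ := (fisherForm_smul_smul Ψ₀ (G μ) (G ν) _).symm

theorem norm_meanTangent_le {Ψ₀ : WalkSpace} (hΨ : ‖Ψ₀‖ = 1) (μ : CoinParam) (t : ℕ) :
    ‖meanTangent Θ Ψ₀ μ t‖ ≤ ‖coinHom (coinGen Θ μ)‖ := by
  refine (ContinuousLinearMap.le_opNorm _ Ψ₀).trans ?_
  rw [hΨ, mul_one]
  exact norm_birkhoffAverage_heisenberg_le _ _ _

theorem tendsto_meanTangent_β (Ψ₀ : WalkSpace) :
    Tendsto (meanTangent Θ Ψ₀ .β) atTop (𝓝 0) := by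
  have h := tendsto_birkhoffAverage_coboundary (stepUnitary Θ) (coinHom coinZ)
  rw [← coinHom_coinGen_β] at h
  exact ((ContinuousLinearMap.apply ℂ WalkSpace Ψ₀).continuous.tendsto 0).comp h

theorem tendsto_qfi_β_right {Ψ₀ : WalkSpace} (hΨ : ‖Ψ₀‖ = 1) (μ : CoinParam) :
    Tendsto (fun t : ℕ => qfi Ψ₀ t Θ μ .β / (t : ℝ) ^ 2) atTop (𝓝 0) := by
  simp only [qfi_div_sq]
  exact tendsto_fisherForm_zero hΨ (norm_meanTangent_le Θ hΨ μ) (tendsto_meanTangent_β Θ Ψ₀)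

theorem tendsto_qfi_β_left {Ψ₀ : WalkSpace} (hΨ : ‖Ψ₀‖ = 1) (μ : CoinParam) :
    Tendsto (fun t : ℕ => qfi Ψ₀ t Θ .β μ / (t : ℝ) ^ 2) atTop (𝓝 0) := by
  simpa only [qfi_div_sq, fisherForm_comm Ψ₀ (meanTangent Θ Ψ₀ .β _)] using
    tendsto_qfi_β_right Θ hΨ μ

end Walk

section Nondegeneracy

variable {Θ : Params}

/-- The limit operator of the time averages of the generator of the parameter `μ`, meaningful
when `sin θ ≠ 0`. -/
def limitGen (Θ : Params) (μ : CoinParam) : WalkSpace →L[ℂ] WalkSpace :=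
  conservedPart (Unitary.toUnits (stepUnitary Θ)) (coinHom (coinGen Θ μ))

theorem tendsto_meanTangent (hs : Real.sin (Θ .θ) ≠ 0) (Ψ₀ : WalkSpace) (μ : CoinParam) :
    Tendsto (meanTangent Θ Ψ₀ μ) atTop (𝓝 (limitGen Θ μ Ψ₀)) :=
  ((ContinuousLinearMap.apply ℂ WalkSpace Ψ₀).continuous.tendsto _).comp <|
    tendsto_birkhoffAverage_conservedPart (norm_stepUnitary_add_star_lt hs)
      (commute_stepUnitary_add_star_coinHom Θ _)

-- The right-hand side is the derivative of `U + U† = p T + p̄ T†`, where `T` is the translation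
-- and `p` the upper left entry of the coin.
theorem sub_star_mul_limitGen (hs : Real.sin (Θ .θ) ≠ 0) (μ : CoinParam) :
    ((stepUnitary Θ).1 - star (stepUnitary Θ).1) * limitGen Θ μ =
      coinDeriv Θ μ 0 0 • translation.1 + star (coinDeriv Θ μ 0 0) • star translation.1 := by
  obtain ⟨p, q, hpq⟩ : ∃ p q, coinDeriv Θ μ = quatMatrix p q := by
    cases μ <;> exact ⟨_, _, rfl⟩
  have hK : star (coinHom (coinGen Θ μ)) = -coinHom (coinGen Θ μ) := by
    rw [← map_star, star_coinGen, map_neg]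
  have hUK : (stepUnitary Θ).1 * coinHom (coinGen Θ μ) =
      shiftUnitary.1 * coinHom (quatMatrix p q) := by
    rw [coe_stepUnitary, mul_assoc, ← map_mul, coin_mul_coinGen, hpq]
  calc
    _ = (stepUnitary Θ).1 * coinHom (coinGen Θ μ) -
        coinHom (coinGen Θ μ) * star (stepUnitary Θ).1 :=
      sub_star_mul_conservedPart (norm_stepUnitary_add_star_lt hs) _
    _ = (stepUnitary Θ).1 * coinHom (coinGen Θ μ) +
        star ((stepUnitary Θ).1 * coinHom (coinGen Θ μ)) := by
      rw [star_mul, hK, neg_mul, sub_eq_add_neg]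
    _ = _ := by
      rw [hUK, shiftUnitary_mul_coinHom_quatMatrix_add_star, hpq]
      rfl

/-- The initial state `|0⟩ ⊗ |0⟩`. -/
def localizedState : WalkSpace :=
  lp.single 2 ((0 : ℤ), (0 : Fin 2)) 1

theorem norm_localizedState : ‖localizedState‖ = 1 := by
  rw [localizedState, lp.norm_single (by norm_num), norm_one]

theorem localizedState_apply (x : ℤ) (j : Fin 2) :
    localizedState (x, j) = if x = 0 ∧ j = 0 then 1 else 0 := by
  simp only [localizedState, lp.single_apply, Pi.single_apply, Prod.mk.injEq]

theorem stepUnitary_sub_star_localizedState_neg_one_one :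
    ((stepUnitary Θ).1 - star (stepUnitary Θ).1) localizedState (-1, 1) = 2 * coin Θ 1 0 := by
  rw [coe_stepUnitary, star_mul, ← map_star, coin_eq_quatMatrix, star_quatMatrix]
  simp [mul_apply_eq_comp, shiftUnitary_apply_one, star_shiftUnitary_apply_zero,
    star_shiftUnitary_apply_one, coinHom_apply, quatMatrix, localizedState_apply, two_mul,
    sub_eq_add_neg]

theorem eq_zero_of_coinDeriv_zero_zero (hs : Real.sin (Θ .θ) ≠ 0) (hc : Real.cos (Θ .θ) ≠ 0)
    {a b : ℝ} (h : a * coinDeriv Θ .θ 0 0 + b * coinDeriv Θ .α 0 0 = 0) : a = 0 ∧ b = 0 := by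
  have hfactor : Complex.exp (Complex.I * Θ .α) *
      (((-(a * Real.sin (Θ .θ)) : ℝ) : ℂ) + ((b * Real.cos (Θ .θ) : ℝ) : ℂ) * Complex.I) = 0 := by
    rw [← h]
    simp only [coinDeriv, quatMatrix, Matrix.of_apply, Matrix.cons_val', Matrix.cons_val_zero,
      Matrix.cons_val_fin_one]
    push_cast
    ring
  have hre := (mul_eq_zero.1 hfactor).resolve_left (Complex.exp_ne_zero _)
  rw [← Complex.mk_eq_add_mul_I, Complex.ext_iff] at hre
  exact ⟨(mul_eq_zero.1 (neg_eq_zero.1 hre.1)).resolve_right hs,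
    (mul_eq_zero.1 hre.2).resolve_right hc⟩

theorem eq_zero_of_sum_limitGen_eq_smul (hs : Real.sin (Θ .θ) ≠ 0) (hc : Real.cos (Θ .θ) ≠ 0)
    {a : Fin 2 → ℝ} {c : ℂ}
    (h : ∑ i, (a i : ℂ) • limitGen Θ (![.θ, .α] i) localizedState = c • localizedState) :
    a = 0 := by
  have happly (x : ℤ) (j : Fin 2) :
      a 0 * (coinDeriv Θ .θ 0 0 * localizedState (x - 1, j) +
          star (coinDeriv Θ .θ 0 0) * localizedState (x + 1, j)) +
        a 1 * (coinDeriv Θ .α 0 0 * localizedState (x - 1, j) +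
          star (coinDeriv Θ .α 0 0) * localizedState (x + 1, j)) =
        c * ((stepUnitary Θ).1 - star (stepUnitary Θ).1) localizedState (x, j) := by
    have hU := congrArg ((stepUnitary Θ).1 - star (stepUnitary Θ).1) h
    rw [Fin.sum_univ_two, map_add, map_smul, map_smul, map_smul, ← mul_apply_eq_comp,
      ← mul_apply_eq_comp, sub_star_mul_limitGen hs, sub_star_mul_limitGen hs] at hU
    simp only [← smul_translation_add_star_apply]
    exact congrArg (fun ψ : WalkSpace => ψ (x, j)) hU
  have hc0 : c = 0 := by
    have h10 : coin Θ 1 0 ≠ 0 := by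
      simpa [coin, -Complex.ofReal_sin] using hs
    have h := happly (-1) 1
    rw [stepUnitary_sub_star_localizedState_neg_one_one] at h
    simpa [localizedState_apply, h10] using h.symm
  have hP := happly 1 0
  rw [hc0, zero_mul] at hP
  obtain ⟨h0, h1⟩ := eq_zero_of_coinDeriv_zero_zero hs hc (a := a 0) (b := a 1) <| by
    simpa [localizedState_apply] using hP
  exact funext <| Fin.forall_fin_two.2 ⟨h0, h1⟩

theorem posDef_fisherForm_limitGen (hs : Real.sin (Θ .θ) ≠ 0) (hc : Real.cos (Θ .θ) ≠ 0) :
    (Matrix.of fun i j : Fin 2 => fisherForm localizedState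
      (limitGen Θ (![.θ, .α] i) localizedState)
      (limitGen Θ (![.θ, .α] j) localizedState)).PosDef :=
  posDef_fisherForm (v := fun i : Fin 2 => limitGen Θ (![.θ, .α] i) localizedState)
    norm_localizedState fun _ _ => eq_zero_of_sum_limitGen_eq_smul hs hc

theorem tendsto_qfi_div_sq (hs : Real.sin (Θ .θ) ≠ 0) (Ψ₀ : WalkSpace) (μ ν : CoinParam) :
    Tendsto (fun t : ℕ => qfi Ψ₀ t Θ μ ν / (t : ℝ) ^ 2) atTop
      (𝓝 (fisherForm Ψ₀ (limitGen Θ μ Ψ₀) (limitGen Θ ν Ψ₀))) := by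
  simp only [qfi_div_sq]
  exact tendsto_fisherForm Ψ₀ (tendsto_meanTangent hs Ψ₀ μ) (tendsto_meanTangent hs Ψ₀ ν)

theorem tendsto_smul_qfi_θα (hs : Real.sin (Θ .θ) ≠ 0) (Ψ₀ : WalkSpace) :
    Tendsto (fun t : ℕ => (1 / (t : ℝ) ^ 2) •
        !![qfi Ψ₀ t Θ .θ .θ, qfi Ψ₀ t Θ .θ .α; qfi Ψ₀ t Θ .α .θ, qfi Ψ₀ t Θ .α .α]) atTop
      (𝓝 (Matrix.of fun i j : Fin 2 =>
        fisherForm Ψ₀ (limitGen Θ (![.θ, .α] i) Ψ₀) (limitGen Θ (![.θ, .α] j) Ψ₀))) := by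
  refine tendsto_pi_nhds.2 fun i => tendsto_pi_nhds.2 fun j => ?_
  have hentry := tendsto_qfi_div_sq hs Ψ₀ (![.θ, .α] i) (![.θ, .α] j)
  refine hentry.congr fun t => ?_
  rw [div_eq_inv_mul, ← one_div]
  fin_cases i <;> fin_cases j <;> rfl

end Nondegeneracy

section Momentum

open Complex (I)

theorem trace_coboundary_mul_eq_zero {n R : Type*} [Fintype n] [DecidableEq n] [CommRing R]
    [StarRing R] {u X : Matrix n n R} (hu : u ∈ unitary (Matrix n n R)) (hX : Commute u X)
    (Z : Matrix n n R) : ((star u * Z * u - Z) * X).trace = 0 := by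
  rw [sub_mul, Matrix.trace_sub, sub_eq_zero, mul_assoc, hX.eq, ← mul_assoc, Matrix.trace_mul_comm,
    mul_assoc (star u), ← mul_assoc u, Unitary.mul_star_self_of_mem hu, one_mul]

variable {k : ℝ} {Θ : Params}

/-- The matrix `i (m · σ)`, where `m` is the vector with `A_k^𝟙 = 1 ⊕ N m mᵀ`. -/
def axisK (k : ℝ) (Θ : Params) : Matrix (Fin 2) (Fin 2) ℂ :=
  quatMatrix (I * (Real.cot (Θ .θ) * Real.sin (k - Θ .α) : ℝ))
    (I * Real.sin (k - Θ .β) - Real.cos (k - Θ .β))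

theorem stepK_eq_quatMatrix_mul_coin (k : ℝ) (Θ : Params) :
    stepK k Θ = quatMatrix (star (Complex.exp (I * k))) 0 * coin Θ := by
  rw [stepK, quatMatrix, star_star, star_exp_I_mul, star_zero, neg_zero]

theorem stepK_mem_unitary (k : ℝ) (Θ : Params) :
    stepK k Θ ∈ unitary (Matrix (Fin 2) (Fin 2) ℂ) := by
  have hphase : star (quatMatrix (star (Complex.exp (I * k))) 0) *
      quatMatrix (star (Complex.exp (I * k))) 0 = 1 := by
    rw [star_quatMatrix, quatMatrix_mul, star_star, mul_comm (Complex.exp _),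
      star_exp_I_mul_self_mul, ← quatMatrix_one_zero]
    simp only [star_zero, mul_zero, neg_zero, sub_zero, zero_mul, add_zero]
  rw [stepK_eq_quatMatrix_mul_coin]
  exact mul_mem (Unitary.mem_iff.2 ⟨hphase, mul_eq_one_comm.1 hphase⟩) (coin_mem_unitary Θ)

theorem dstepK_eq_quatMatrix_mul_coinDeriv (k : ℝ) (Θ : Params) (μ : CoinParam) :
    dstepK k Θ μ = quatMatrix (star (Complex.exp (I * k))) 0 * coinDeriv Θ μ := by
  ext i j
  refine HasDerivAt.deriv ?_
  simp only [stepK_eq_quatMatrix_mul_coin, Matrix.mul_apply]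
  exact HasDerivAt.fun_sum fun l _ => (hasDerivAt_coin Θ μ l j).const_mul _

theorem genO_β (k : ℝ) (Θ : Params) :
    genO k Θ .β = star (stepK k Θ) * coinZ * stepK k Θ - coinZ := by
  have hZ : Commute (quatMatrix (star (Complex.exp (I * k))) 0) coinZ := by
    simp [commute_iff_eq, coinZ, quatMatrix_mul, mul_comm]
  have hd : dstepK k Θ .β = coinZ * stepK k Θ - stepK k Θ * coinZ := by
    rw [dstepK_eq_quatMatrix_mul_coinDeriv, coinDeriv_β, stepK_eq_quatMatrix_mul_coin, mul_sub,
      ← mul_assoc, hZ.eq, mul_assoc, mul_assoc]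
  rw [genO, hd, ← Matrix.star_eq_conjTranspose, mul_sub, mul_assoc,
    ← mul_assoc _ (stepK k Θ) coinZ, Unitary.star_mul_self_of_mem (stepK_mem_unitary k Θ), one_mul]

theorem star_exp_I_mul_mul_exp_I_mul (x y : ℝ) :
    star (Complex.exp (I * x)) * Complex.exp (I * y) =
      Real.cos (x - y) - Real.sin (x - y) * I := by
  rw [star_exp_I_mul, ← Complex.exp_add,
    show -(I * x) + I * y = ((-(x - y) : ℝ) : ℂ) * I by push_cast; ring, Complex.exp_mul_I,
    ← Complex.ofReal_cos, ← Complex.ofReal_sin, Real.cos_neg, Real.sin_neg, Complex.ofReal_neg,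
    neg_mul, ← sub_eq_add_neg]

theorem stepK_eq_sub_axisK (hs : Real.sin (Θ .θ) ≠ 0) :
    stepK k Θ = ((Real.cos (Θ .θ) * Real.cos (k - Θ .α) : ℝ) : ℂ) • 1 -
      (Real.sin (Θ .θ) : ℂ) • axisK k Θ := by
  have hα := star_exp_I_mul_mul_exp_I_mul k (Θ .α)
  have hβ := star_exp_I_mul_mul_exp_I_mul k (Θ .β)
  have hcot : (Real.sin (Θ .θ) : ℂ) * Real.cot (Θ .θ) = Real.cos (Θ .θ) := by
    rw [Real.cot_eq_cos_div_sin, Complex.ofReal_div, mul_div_cancel₀ _ (by exact_mod_cast hs)]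
  have hstep : stepK k Θ = quatMatrix
      ((Real.cos (k - Θ .α) - Real.sin (k - Θ .α) * I) * Real.cos (Θ .θ))
      ((Real.cos (k - Θ .β) - Real.sin (k - Θ .β) * I) * Real.sin (Θ .θ)) := by
    rw [stepK_eq_quatMatrix_mul_coin, coin_eq_quatMatrix, quatMatrix_mul, ← hα, ← hβ]
    simp only [zero_mul, sub_zero, add_zero, mul_assoc]
  rw [hstep, eq_sub_iff_add_eq, axisK, ← quatMatrix_one_zero, ofReal_smul_quatMatrix,
    ofReal_smul_quatMatrix, quatMatrix_add, Complex.ofReal_mul, Complex.ofReal_mul, ← hcot]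
  congr 1 <;> ring

theorem commute_stepK_axisK (hs : Real.sin (Θ .θ) ≠ 0) : Commute (stepK k Θ) (axisK k Θ) := by
  rw [stepK_eq_sub_axisK hs]
  exact ((Commute.one_left _).smul_left _).sub_left ((Commute.refl _).smul_left _)

theorem projA_mulVec_blochVec_eq_zero {O : Matrix (Fin 2) (Fin 2) ℂ} (h : O.trace = 0)
    (haxis : (O * axisK k Θ).trace = 0) : (projA k Θ).mulVec (blochVec O) = 0 := by
  have hm : Real.sin (k - Θ .β) * blochVec O 1 - Real.cos (k - Θ .β) * blochVec O 2 +
      Real.cot (Θ .θ) * Real.sin (k - Θ .α) * blochVec O 3 = 0 := by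
    refine (mul_eq_zero.1 (Eq.trans ?_ haxis)).resolve_left Complex.I_ne_zero
    simp only [blochVec, pauli, Matrix.cons_val_one, Matrix.cons_val_zero, Matrix.cons_val,
      Matrix.trace_fin_two, Matrix.mul_apply, Matrix.of_apply, Matrix.cons_val',
      Matrix.cons_val_fin_one, Fin.sum_univ_two, axisK, quatMatrix, Complex.ofReal_mul, star_sub,
      star_mul', Complex.star_def, Complex.conj_I, Complex.conj_ofReal]
    linear_combination (O 1 0 - O 0 1) * Real.cos (k - Θ .β) * Complex.I_sq
  have h0 : blochVec O 0 = 0 := by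
    simpa [blochVec, pauli] using h
  ext i
  fin_cases i <;>
    simp only [projA, projAReal, Matrix.mulVec, dotProduct, Fin.sum_univ_four, h0, Fin.zero_eta,
      Fin.mk_one, Fin.reduceFinMk, Matrix.smul_of, Matrix.smul_cons, smul_eq_mul, mul_zero,
      Matrix.smul_empty, Matrix.map_apply, Matrix.of_apply, Matrix.cons_val', Matrix.cons_val,
      Matrix.cons_val_fin_one, Matrix.cons_val_one, Matrix.cons_val_zero, Complex.ofReal_zero,
      Complex.ofReal_mul, Complex.ofReal_neg, Complex.ofReal_pow, zero_mul, add_zero, zero_add,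
      Pi.zero_apply]
  · linear_combination (normN k Θ : ℂ) * Real.sin (k - Θ .β) * hm
  · linear_combination -(normN k Θ : ℂ) * Real.cos (k - Θ .β) * hm
  · linear_combination (normN k Θ : ℂ) * Real.cot (Θ .θ) * Real.sin (k - Θ .α) * hm

theorem projA_mulVec_blochVec_genO_β (hs : Real.sin (Θ .θ) ≠ 0) (k : ℝ) :
    (projA k Θ).mulVec (blochVec (genO k Θ .β)) = 0 := by
  rw [genO_β]
  refine projA_mulVec_blochVec_eq_zero ?_
    (trace_coboundary_mul_eq_zero (stepK_mem_unitary k Θ) (commute_stepK_axisK hs) _)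
  simpa only [mul_one] using
    trace_coboundary_mul_eq_zero (stepK_mem_unitary k Θ) (Commute.one_right _) coinZ

theorem isHermitian_projA (k : ℝ) (Θ : Params) : (projA k Θ).IsHermitian := by
  have hreal : (projAReal k Θ).IsHermitian := by
    ext i j
    fin_cases i <;> fin_cases j <;> simp [projAReal]
  exact hreal.map _ fun x => (Complex.conj_ofReal x).symm

theorem sandwich_eq_zero_right {w : Fin 4 → ℂ} (hw : (projA k Θ).mulVec w = 0) (v : Fin 4 → ℂ) :
    sandwich k Θ v w = 0 := by
  rw [sandwich, hw, dotProduct_zero]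

theorem sandwich_eq_zero_left {w : Fin 4 → ℂ} (hw : (projA k Θ).mulVec w = 0) (v : Fin 4 → ℂ) :
    sandwich k Θ w v = 0 := by
  rw [sandwich, Matrix.dotProduct_mulVec, ← (isHermitian_projA k Θ).eq, ← Matrix.star_mulVec, hw,
    star_zero, zero_dotProduct]

theorem qfiAsymp_β_right (hs : Real.sin (Θ .θ) ≠ 0) (φ : ℝ → EuclideanSpace ℂ (Fin 2)) (t : ℕ)
    (μ : CoinParam) : qfiAsymp φ t Θ μ .β = 0 := by
  simp [qfiAsymp, sandwich_eq_zero_right (projA_mulVec_blochVec_genO_β hs _)]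

theorem qfiAsymp_β_left (hs : Real.sin (Θ .θ) ≠ 0) (φ : ℝ → EuclideanSpace ℂ (Fin 2)) (t : ℕ)
    (μ : CoinParam) : qfiAsymp φ t Θ .β μ = 0 := by
  simp [qfiAsymp, sandwich_eq_zero_left (projA_mulVec_blochVec_genO_β hs _)]

end Momentum

end

end QWalk

open QWalk

theorem corollary1 :
    -- `A_k^𝟙` annihilates the Bloch vector of `O_β`
    (∀ Θ : Params, Real.sin (Θ .θ) ≠ 0 → ∀ k : ℝ,
      (projA k Θ).mulVec (blochVec (genO k Θ .β)) = 0) ∧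
    -- every element involving `β` of the asymptotic expression for the QFI matrix vanishes
    (∀ Θ : Params, Real.sin (Θ .θ) ≠ 0 →
      ∀ (Ψ₀ : WalkSpace) (φ : ℝ → EuclideanSpace ℂ (Fin 2)),
        ‖Ψ₀‖ = 1 → IsMomentumAmplitude Ψ₀ φ →
        ∀ (t : ℕ) (μ : CoinParam), qfiAsymp φ t Θ μ .β = 0 ∧ qfiAsymp φ t Θ .β μ = 0) ∧
    -- for every initial state, the elements involving `β` of the QFI matrix of the walk
    -- vanish at order `t²`
    (∀ (Θ : Params) (Ψ₀ : WalkSpace), ‖Ψ₀‖ = 1 →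
      (∀ (t : ℕ) (μ : CoinParam), DifferentiableAt ℝ (stateAlong Ψ₀ t Θ μ) (Θ μ)) ∧
      ∀ μ : CoinParam,
        Filter.Tendsto (fun t : ℕ => qfi Ψ₀ t Θ μ .β / (t : ℝ) ^ 2) Filter.atTop (nhds 0) ∧
        Filter.Tendsto (fun t : ℕ => qfi Ψ₀ t Θ .β μ / (t : ℝ) ^ 2) Filter.atTop (nhds 0)) ∧
    -- `θ` and `α` can be estimated: for a suitable initial state, their block of the QFI matrix
    -- is nondegenerate at order `t²`
    (∃ Ψ₀ : WalkSpace, ‖Ψ₀‖ = 1 ∧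
      ∀ Θ : Params, Real.sin (Θ .θ) ≠ 0 → Real.cos (Θ .θ) ≠ 0 →
        ∃ G : Matrix (Fin 2) (Fin 2) ℝ, G.PosDef ∧
          Filter.Tendsto
            (fun t : ℕ => (1 / (t : ℝ) ^ 2) •
              !![qfi Ψ₀ t Θ .θ .θ, qfi Ψ₀ t Θ .θ .α; qfi Ψ₀ t Θ .α .θ, qfi Ψ₀ t Θ .α .α])
            Filter.atTop (nhds G)) := by
  refine ⟨fun Θ hs k => projA_mulVec_blochVec_genO_β hs k,
    fun Θ hs Ψ₀ φ _ _ t μ => ⟨qfiAsymp_β_right hs φ t μ, qfiAsymp_β_left hs φ t μ⟩,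
    fun Θ Ψ₀ hΨ => ⟨fun t μ => (hasDerivAt_stateAlong Θ Ψ₀ t μ).differentiableAt,
      fun μ => ⟨tendsto_qfi_β_right Θ hΨ μ, tendsto_qfi_β_left Θ hΨ μ⟩⟩,
    localizedState, norm_localizedState, fun Θ hs hc => ?_⟩
  exact ⟨_, posDef_fisherForm_limitGen hs hc, tendsto_smul_qfi_θα hs localizedState⟩
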